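/- Let $d\ge 2$ and $\bar L>0$, and let $f:\mathbb R^d\to\mathbb R$ belong to $\mathcal F_2(\bar L)$, i.e. $f$ is continuously differentiable and $\|\nabla f(x)-\nabla f(z)\|\le \bar L\|x-z\|$ for all $x,z\in\mathbb R^d$ ($\|\cdot\|$ is the Euclidean norm). Let $K:[-1,1]\to\mathbb R$ be measurable and put $\kappa=\int_{-1}^1K(r)^2\,dr\in[0,\infty]$. Let $\Theta\subset\mathbb R^d$ be closed, $T\ge1$, and $\eta_t,h_t>0$ for $t=1,\dots,T$. Consider the zero-order projected gradient algorithm with $\ell_2$-randomization: $x_1\in\Theta$ and, for $t=1,\dots,T$, with $\zeta_t^\circ$ uniformly distributed on the Euclidean unit sphere and $r_t$ uniformly distributed on $[-1,1]$, the pairs $(\zeta_t^\circ,r_t)$, $t=1,\dots,T$, being independent and the pair $(\zeta_t^\circ,r_t)$ being drawn independently of the current point $x_t$, $$y_t=f(x_t+h_tr_t\zeta_t^\circ)+\xi_t,\qquad y_t'=f(x_t-h_tr_t\zeta_t^\circ)+\xi_t',\qquad g_t^\circ=\frac{d}{2h_t}(y_t-y_t')\,K(r_t)\,\zeta_t^\circ,\qquad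 x_{t+1}=\mathrm{Proj}_\Theta(x_t-\eta_tg_t^\circ),$$ where $\mathrm{Proj}_\Theta(y)$ is a point of $\Theta$ at minimal Euclidean distance to $y$. Assume that for every $t\in\{1,\dots,T\}$: (i) conditionally on $x_t$, each of $\xi_t$ and $\xi_t'$ is independent of $\zeta_t^\circ$ and of $r_t$; moreover, $\zeta_t^\circ$ and $r_t$ are independent of each other; (ii) $\mathbf E[\xi_t^2]\le\sigma^2$ and $\mathbf E[(\xi_t')^2]\le\sigma^2$, where $\sigma\ge0$. Then, for every $t\in\{1,\dots,T\}$ (expectations of nonnegative variables being taken in $[0,\infty]$, with $0\cdot\infty=0$), $$\mathbf E\|g_t^\circ\|^2\le\frac{d^2\kappa}{d-1}\,\mathbf E\Big[\big(\|\nabla f(x_t)\|+\bar Lh_t\big)^2\Big]+\frac{d^2\sigma^2\kappa}{h_t^2},$$ and, in particular (with the $h_t^2$ term multiplied by $d$ rather than $d^2$), $$\mathbf E\|g_t^\circ\|^2\le4d\kappa\,\mathbf E\|\nabla f(x_t)\|^2+4d\kappa\bar L^2h_t^2+\frac{d^2\sigma^2\kappa}{h_t^2}.$$ -/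

import Mathlib

open MeasureTheory ProbabilityTheory
open scoped ENNReal

namespace ZeroOrder

noncomputable section

/-- The largest integer strictly smaller than `β` (for `β > 0`). -/
def strictFloor (β : ℝ) : ℕ := ⌈β⌉₊ - 1

/-- The Hölder class `F_β(L)` on `ℝ^d`: with `ℓ` the largest integer strictly smaller than `β`,
the functions that are `ℓ` times continuously differentiable and whose `ℓ`-th derivative, as an
`ℓ`-linear form with the norm `‖A‖ = sup {|A[h₁, …, h_ℓ]| : ‖h_j‖ ≤ 1}`, is
`(β - ℓ)`-Hölder with constant `L`. -/
def HolderClass {d : ℕ} (β L : ℝ) : Set (EuclideanSpace ℝ (Fin d) → ℝ) :=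
  {f | ContDiff ℝ (strictFloor β) f ∧
    ∀ x z, ‖iteratedFDeriv ℝ (strictFloor β) f x - iteratedFDeriv ℝ (strictFloor β) f z‖ ≤
      L * ‖x - z‖ ^ (β - strictFloor β)}

/-- The uniform distribution on the Euclidean unit sphere of `ℝ^d`: the normalized surface measure,
seen as a measure on `ℝ^d`. -/
def uniformSphere (d : ℕ) : Measure (EuclideanSpace ℝ (Fin d)) :=
  (cond (volume : Measure (EuclideanSpace ℝ (Fin d))).toSphere Set.univ).map Subtype.val

/-- The uniform distribution on the interval `[-1, 1]`. -/
def uniformInterval : Measure ℝ := cond volume (Set.Icc (-1) 1)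

/-- `κ = ∫_{-1}^{1} K(r)² dr`, as an element of `[0, ∞]`. -/
def kappa (K : ℝ → ℝ) : ℝ≥0∞ := ∫⁻ r in Set.Icc (-1 : ℝ) 1, ENNReal.ofReal (K r ^ 2)

/-- `X` and `Y` are conditionally independent given the random variable `Z`:
`P(X ∈ s, Y ∈ t | Z) = P(X ∈ s | Z) P(Y ∈ t | Z)` almost surely, for all measurable `s`, `t`. -/
def CondIndepGiven {Ω A B C : Type*} [MeasurableSpace Ω] [MeasurableSpace A] [MeasurableSpace B]
    [mC : MeasurableSpace C] (P : Measure Ω) (Z : Ω → C) (X : Ω → A) (Y : Ω → B) : Prop :=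
  ∀ (s : Set A) (t : Set B), MeasurableSet s → MeasurableSet t →
    P⟦X ⁻¹' s ∩ Y ⁻¹' t | mC.comap Z⟧ =ᵐ[P]
      fun ω => (P⟦X ⁻¹' s | mC.comap Z⟧) ω * (P⟦Y ⁻¹' t | mC.comap Z⟧) ω

/-- The gradient estimator `(d / (2h)) (y - y') K(r) ζ` at the point `x`, built from the noisy
values `y = f(x + h r ζ) + ξ` and `y' = f(x - h r ζ) + ξ'`. -/
def gradEstimator {d : ℕ} (f : EuclideanSpace ℝ (Fin d) → ℝ) (K : ℝ → ℝ) (h : ℝ)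
    (x ζ : EuclideanSpace ℝ (Fin d)) (r ξ ξ' : ℝ) : EuclideanSpace ℝ (Fin d) :=
  ((d : ℝ) / (2 * h) * ((f (x + (h * r) • ζ) + ξ) - (f (x - (h * r) • ζ) + ξ')) * K r) • ζ

/-- `p` is a Euclidean projection of `y` onto `Θ`, that is, a point of `Θ` nearest to `y`. -/
def IsProjOn {d : ℕ} (Θ : Set (EuclideanSpace ℝ (Fin d))) (y p : EuclideanSpace ℝ (Fin d)) : Prop :=
  p ∈ Θ ∧ ∀ z ∈ Θ, ‖p - y‖ ≤ ‖z - y‖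

/-- The zero-order stochastic projected gradient algorithm with `ℓ₂`-randomization, run for `T`
steps on the objective `f` with kernel `K`, constraint set `Θ`, step sizes `η`, discretization
parameters `h`, randomizations `ζ`, `r` and noises `ξ`, `ξ'`; the iterates are `x`.
Times are `1, …, T`; values of the sequences at other times are irrelevant. -/
structure IsSphereRun {Ω : Type*} [MeasurableSpace Ω] (P : Measure Ω) {d : ℕ}
    (f : EuclideanSpace ℝ (Fin d) → ℝ) (K : ℝ → ℝ) (Θ : Set (EuclideanSpace ℝ (Fin d)))
    (η h : ℕ → ℝ) (T : ℕ) (x ζ : ℕ → Ω → EuclideanSpace ℝ (Fin d)) (r ξ ξ' : ℕ → Ω → ℝ) :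
    Prop where
  isClosed : IsClosed Θ
  step_pos : ∀ t ∈ Finset.Icc 1 T, 0 < η t
  h_pos : ∀ t ∈ Finset.Icc 1 T, 0 < h t
  measurable_x : ∀ t ∈ Finset.Icc 1 T, Measurable (x t)
  measurable_zeta : ∀ t ∈ Finset.Icc 1 T, Measurable (ζ t)
  measurable_r : ∀ t ∈ Finset.Icc 1 T, Measurable (r t)
  measurable_xi : ∀ t ∈ Finset.Icc 1 T, Measurable (ξ t)
  measurable_xi' : ∀ t ∈ Finset.Icc 1 T, Measurable (ξ' t)
  law_zeta : ∀ t ∈ Finset.Icc 1 T, HasLaw (ζ t) (uniformSphere d) P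
  law_r : ∀ t ∈ Finset.Icc 1 T, HasLaw (r t) uniformInterval P
  /-- The randomizations of different steps are drawn independently. -/
  indep_draws : iIndepFun (fun (t : Finset.Icc 1 T) (ω : Ω) => (ζ t ω, r t ω)) P
  /-- The randomization of step `t` is drawn afresh at the current point. -/
  fresh : ∀ t ∈ Finset.Icc 1 T, IndepFun (fun ω => (ζ t ω, r t ω)) (x t) P
  init : ∀ᵐ ω ∂P, x 1 ω ∈ Θ
  update : ∀ t ∈ Finset.Icc 1 T, ∀ᵐ ω ∂P,
    IsProjOn Θ (x t ω - η t • gradEstimator f K (h t) (x t ω) (ζ t ω) (r t ω) (ξ t ω) (ξ' t ω))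
      (x (t + 1) ω)

/-- The noise assumption: (i) given `x_t`, each of the noises is independent of `ζ_t` and of
`r_t`, and `ζ_t` and `r_t` are independent; (ii) the second moments of the noises are at most
`σ²`. The noises may be biased, and dependent on each other and across time. -/
structure NoiseAssumption {Ω : Type*} [MeasurableSpace Ω] (P : Measure Ω) {d : ℕ} (σ : ℝ) (T : ℕ)
    (x ζ : ℕ → Ω → EuclideanSpace ℝ (Fin d)) (r ξ ξ' : ℕ → Ω → ℝ) : Prop where
  sigma_nonneg : 0 ≤ σ
  xi_zeta : ∀ t ∈ Finset.Icc 1 T, CondIndepGiven P (x t) (ξ t) (ζ t)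
  xi_r : ∀ t ∈ Finset.Icc 1 T, CondIndepGiven P (x t) (ξ t) (r t)
  xi'_zeta : ∀ t ∈ Finset.Icc 1 T, CondIndepGiven P (x t) (ξ' t) (ζ t)
  xi'_r : ∀ t ∈ Finset.Icc 1 T, CondIndepGiven P (x t) (ξ' t) (r t)
  zeta_r : ∀ t ∈ Finset.Icc 1 T, IndepFun (ζ t) (r t) P
  moment_xi : ∀ t ∈ Finset.Icc 1 T, ∫⁻ ω, ENNReal.ofReal (ξ t ω ^ 2) ∂P ≤ ENNReal.ofReal (σ ^ 2)
  moment_xi' : ∀ t ∈ Finset.Icc 1 T,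
    ∫⁻ ω, ENNReal.ofReal (ξ' t ω ^ 2) ∂P ≤ ENNReal.ofReal (σ ^ 2)

end

end ZeroOrder

/-!
The squared norm of the estimator is split by `(a + b + c)² ≤ 2a² + 4b² + 4c²` into the squared
difference of function values and the squared noises (`norm_sq_gradEstimator_le`). With this choice
of weights no cross term has to vanish, and both constants of the theorem come out exactly.

For the noises, conditional independence of `ξ_t` and `r_t` given `x_t`, together with independence
of `r_t` and `x_t`, makes `ξ_t` and `r_t` independent (`CondIndepGiven.indepFun`), so that
`E[ξ_t² K(r_t)²] ≤ σ² κ / 2`.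

For the function values, the pair `(ζ_t, r_t)` is independent of `x_t`, so it suffices to bound, for
fixed `x` and `|ρ| ≤ h`, the second moment of the odd function
`F(u) = f(x + ρu) - f(x - ρu)` under the uniform distribution of the sphere. Its gradient is at most
`2h(‖∇f(x)‖ + L h)` there, so the Poincaré inequality `(d - 1) E[F²] ≤ E[‖∇F‖²]` on the sphere
(`sub_one_mul_lintegral_sq_le_lintegral_gradient_sq`) gives the factor `1 / (d - 1)`.

The Poincaré inequality for odd functions is deduced from its Gaussian counterpart
(`lintegral_sq_le_lintegral_gradient_sq_stdGaussian`), applied to the extension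
`u ↦ ‖u‖ F(u / ‖u‖)`. The Gaussian inequality in turn is Wirtinger's inequality on the circle for
antiperiodic functions (`integral_sq_le_integral_deriv_sq_of_antiperiodic`), averaged over the
random ellipses `θ ↦ cos θ X + sin θ Y` through independent Gaussian vectors `X` and `Y`.
-/

namespace ZeroOrder

open scoped RealInnerProductSpace

/-! ### Wirtinger's inequality for antiperiodic functions -/

/-- Wirtinger's inequality: an antiperiodic function has mean zero, and every other Fourier
coefficient of `ψ'` is at least as large in modulus as that of `ψ`, so Parseval's identity gives the
claim. -/
theorem integral_sq_le_integral_deriv_sq_of_antiperiodic {ψ ψ' : ℝ → ℝ}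
    (hψ : ∀ θ, HasDerivAt ψ (ψ' θ) θ) (hψ' : Continuous ψ')
    (hanti : Function.Antiperiodic ψ Real.pi) :
    ∫ θ in (0 : ℝ)..2 * Real.pi, ψ θ ^ 2 ≤ ∫ θ in (0 : ℝ)..2 * Real.pi, ψ' θ ^ 2 := by
  have hpi := Real.pi_pos
  have hab : (0 : ℝ) < 2 * Real.pi := by positivity
  have hcont : Continuous ψ := continuous_iff_continuousAt.2 fun θ => (hψ θ).continuousAt
  have hmem : ∀ {g : ℝ → ℝ}, Continuous g →
      MemLp (fun θ => (g θ : ℂ)) 2 (volume.restrict (Set.Ioc 0 (2 * Real.pi))) := by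
    intro g hg
    have hg' : Continuous fun θ => (g θ : ℂ) := by fun_prop
    obtain ⟨C, hC⟩ := isCompact_Icc.exists_bound_of_continuousOn (s := Set.Icc 0 (2 * Real.pi))
      hg'.continuousOn
    refine MemLp.of_bound hg'.aestronglyMeasurable C ?_
    filter_upwards [ae_restrict_mem measurableSet_Ioc] with θ hθ
      using hC θ (Set.Ioc_subset_Icc_self hθ)
  have hsum := hasSum_sq_fourierCoeffOn hab (hmem hcont)
  have hsum' := hasSum_sq_fourierCoeffOn hab (hmem hψ')
  have hzero : ∫ θ in (0 : ℝ)..2 * Real.pi, ψ θ = 0 := by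
    have h1 : ∫ θ in (0 : ℝ)..2 * Real.pi, ψ θ
        = (∫ θ in (0 : ℝ)..Real.pi, ψ θ) + ∫ θ in Real.pi..2 * Real.pi, ψ θ :=
      (intervalIntegral.integral_add_adjacent_intervals (hcont.intervalIntegrable _ _)
        (hcont.intervalIntegrable _ _)).symm
    have h2 : ∫ θ in (0 : ℝ)..Real.pi, ψ (θ + Real.pi) = ∫ θ in Real.pi..2 * Real.pi, ψ θ := by
      rw [intervalIntegral.integral_comp_add_right (f := ψ)]
      congr 1 <;> ring
    rw [h1, ← h2]
    simp only [hanti _, intervalIntegral.integral_neg, add_neg_cancel]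
  have hle := hasSum_le (fun n : ℤ => ?_) hsum hsum'
  · simp only [sub_zero, smul_eq_mul, Complex.norm_real, Real.norm_eq_abs, sq_abs] at hle
    exact le_of_mul_le_mul_left hle (inv_pos.2 hab)
  by_cases hn : n = 0
  · subst hn
    have : fourierCoeffOn hab (fun θ => (ψ θ : ℂ)) 0 = 0 := by
      rw [fourierCoeffOn_eq_integral]
      simp [intervalIntegral.integral_ofReal, hzero]
    rw [this]
    simp
  · have hper : ψ (2 * Real.pi) = ψ 0 := by
      have := hanti.periodic_two_mul 0
      simpa using this
    have hcoef := fourierCoeffOn_of_hasDerivAt hab (f := fun θ => (ψ θ : ℂ))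
      (f' := fun θ => (ψ' θ : ℂ)) hn (fun θ _ => (hψ θ).ofReal_comp)
      ((Complex.continuous_ofReal.comp hψ').intervalIntegrable _ _)
    have hn1 : (1 : ℝ) ≤ ‖(n : ℂ)‖ := by
      rw [Complex.norm_intCast]
      exact_mod_cast Int.one_le_abs hn
    rw [hcoef]
    simp only [hper, sub_self, mul_zero, zero_sub, norm_mul, norm_neg, norm_div, norm_one]
    have hnorm : ‖(2 : ℂ)‖ * ‖(Real.pi : ℂ)‖ = 2 * Real.pi := by
      simp [abs_of_pos hpi]
    have h0 : ‖((2 * Real.pi : ℝ) : ℂ) - ((0 : ℝ) : ℂ)‖ = 2 * Real.pi := by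
      simp [abs_of_pos hpi]
    gcongr
    rw [h0, hnorm, Complex.norm_I, mul_one]
    set c := ‖fourierCoeffOn hab (fun θ => (ψ' θ : ℂ)) n‖
    have hc : 0 ≤ c := norm_nonneg _
    have : 1 / (2 * Real.pi * ‖(n : ℂ)‖) * (2 * Real.pi * c) = c / ‖(n : ℂ)‖ := by
      have : ‖(n : ℂ)‖ ≠ 0 := by positivity
      field_simp
    rw [this]
    exact div_le_self hc hn1

/-! ### The standard Gaussian measure in polar coordinates -/

section GaussianMeasure

variable {E : Type*} [NormedAddCommGroup E] [InnerProductSpace ℝ E] [FiniteDimensional ℝ E]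
  [MeasurableSpace E] [BorelSpace E]

/-- The standard Gaussian has its usual density: the two measures have the same characteristic
function. -/
theorem stdGaussian_eq_withDensity :
    stdGaussian E = (volume : Measure E).withDensity fun x =>
      ENNReal.ofReal ((2 * Real.pi) ^ (-(Module.finrank ℝ E : ℝ) / 2) *
        Real.exp (-(1 / 2) * ‖x‖ ^ 2)) := by
  set c : ℝ := (2 * Real.pi) ^ (-(Module.finrank ℝ E : ℝ) / 2) with hc
  have hpi := Real.pi_pos
  have hc0 : 0 < c := by positivity
  have hint := GaussianFourier.integral_rexp_neg_mul_sq_norm (V := E) (b := 1 / 2) (by norm_num)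
  have hpow : (Real.pi / (1 / 2)) ^ ((Module.finrank ℝ E : ℝ) / 2) = c⁻¹ := by
    rw [hc, neg_div, Real.rpow_neg (by positivity), inv_inv]
    congr 1
    ring
  rw [hpow] at hint
  have hI : Integrable (fun x : E => Real.exp (-(1 / 2) * ‖x‖ ^ 2)) := by
    by_contra h
    rw [integral_undef h] at hint
    have := inv_pos.2 hc0
    linarith
  have hmeas : Measurable fun x : E => ENNReal.ofReal (c * Real.exp (-(1 / 2) * ‖x‖ ^ 2)) := by
    fun_prop
  have hfin : IsFiniteMeasure ((volume : Measure E).withDensity fun x =>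
      ENNReal.ofReal (c * Real.exp (-(1 / 2) * ‖x‖ ^ 2))) :=
    isFiniteMeasure_withDensity_ofReal (hI.const_mul c).2
  refine Measure.ext_of_charFun (funext fun t => ?_)
  rw [charFun_stdGaussian, charFun_apply,
    integral_withDensity_eq_integral_toReal_smul hmeas (by simp)]
  have hF := GaussianFourier.integral_cexp_neg_mul_sq_norm_add (V := E) (b := 1 / 2) (by norm_num)
    Complex.I t
  have : ∀ x : E, (ENNReal.ofReal (c * Real.exp (-(1 / 2) * ‖x‖ ^ 2))).toReal •
      Complex.exp (⟪x, t⟫ * Complex.I)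
        = c * Complex.exp (-(1 / 2) * ‖x‖ ^ 2 + Complex.I * ⟪t, x⟫) := by
    intro x
    rw [ENNReal.toReal_ofReal (by positivity), Complex.exp_add, real_inner_comm, Complex.real_smul]
    push_cast
    rw [mul_comm Complex.I]
    ring
  simp_rw [this]
  rw [integral_const_mul, hF]
  have hpow' : ((Real.pi : ℂ) / (1 / 2)) ^ ((Module.finrank ℝ E : ℂ) / 2) = ((c⁻¹ : ℝ) : ℂ) := by
    rw [← hpow, Complex.ofReal_cpow (by positivity)]
    push_cast
    rfl
  rw [hpow', ← mul_assoc, ← Complex.ofReal_mul, mul_inv_cancel₀ hc0.ne', Complex.I_sq]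
  simp
  congr 1
  ring

theorem lintegral_polar [Nontrivial E] {A : E → ℝ≥0∞} {B : ℝ → ℝ≥0∞} (hA : Measurable A)
    (hB : Measurable B) :
    ∫⁻ x : E, A (‖x‖⁻¹ • x) * B ‖x‖ =
      (∫⁻ u, A u ∂(volume : Measure E).toSphere) *
        ∫⁻ r, B r ∂Measure.volumeIoiPow (Module.finrank ℝ E - 1) := by
  rw [← lintegral_prod_mul (by fun_prop) (by fun_prop),
    ← ((volume : Measure E).measurePreserving_homeomorphUnitSphereProd).lintegral_comp
      (by fun_prop)]
  simp only [homeomorphUnitSphereProd_apply_fst_coe, homeomorphUnitSphereProd_apply_snd_coe]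
  rw [lintegral_subtype_comap (measurableSet_singleton (0 : E)).compl
    (fun x => A (‖x‖⁻¹ • x) * B ‖x‖), restrict_compl_singleton]

/-- Under the standard Gaussian the direction `x / ‖x‖` is uniform on the sphere and independent of
the norm `‖x‖`. -/
theorem lintegral_stdGaussian_polar [Nontrivial E] {A : E → ℝ≥0∞} {B : ℝ → ℝ≥0∞}
    (hA : Measurable A) (hB : Measurable B) :
    ∫⁻ x, A (‖x‖⁻¹ • x) * B ‖x‖ ∂stdGaussian E =
      (∫⁻ u, A u ∂(cond (volume : Measure E).toSphere Set.univ).map Subtype.val) *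
        ∫⁻ x, B ‖x‖ ∂stdGaussian E := by
  set S := (volume : Measure E).toSphere
  set w : ℝ → ℝ≥0∞ := fun r => ENNReal.ofReal ((2 * Real.pi) ^ (-(Module.finrank ℝ E : ℝ) / 2) *
        Real.exp (-(1 / 2) * r ^ 2)) with hw
  have hwm : Measurable w := by fun_prop
  have key : ∀ {A : E → ℝ≥0∞} {B : ℝ → ℝ≥0∞}, Measurable A → Measurable B →
      ∫⁻ x, A (‖x‖⁻¹ • x) * B ‖x‖ ∂stdGaussian E = (∫⁻ u, A u ∂S) *
        ∫⁻ r, w r * B r ∂Measure.volumeIoiPow (Module.finrank ℝ E - 1) := by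
    intro A B hA hB
    rw [stdGaussian_eq_withDensity, lintegral_withDensity_eq_lintegral_mul _ (by fun_prop)
      (by fun_prop), ← lintegral_polar hA (B := fun r => w r * B r) (by fun_prop)]
    refine lintegral_congr fun x => ?_
    simp only [Pi.mul_apply, hw]
    ring
  have h1 := key (A := fun _ => 1) measurable_const hB
  simp only [one_mul, lintegral_const] at h1
  have hS0 : S Set.univ ≠ 0 := by
    exact Measure.measure_univ_ne_zero.2 (volume : Measure E).toSphere_ne_zero
  rw [key hA hB, h1, lintegral_map hA measurable_subtype_coe, ProbabilityTheory.cond,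
    Measure.restrict_univ, lintegral_smul_measure, smul_eq_mul]
  rw [mul_mul_mul_comm, ENNReal.inv_mul_cancel hS0 (measure_ne_top _ _), one_mul]

theorem lintegral_inner_sq_stdGaussian (a : E) :
    ∫⁻ y, ENNReal.ofReal (⟪a, y⟫ ^ 2) ∂stdGaussian E = ENNReal.ofReal (‖a‖ ^ 2) := by
  have hvar := variance_dual_stdGaussian (innerSL ℝ a)
  have hint := integral_strongDual_stdGaussian (innerSL ℝ a)
  have hmem : MemLp (innerSL ℝ a) 2 (stdGaussian E) :=
    IsGaussian.memLp_dual _ _ 2 (by simp)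
  rw [innerSL_apply_norm] at hvar
  rw [← hvar, ofReal_variance hmem, evariance_eq_lintegral_ofReal, hint]
  simp

theorem lintegral_norm_sq_stdGaussian :
    ∫⁻ x, ENNReal.ofReal (‖x‖ ^ 2) ∂stdGaussian E = Module.finrank ℝ E := by
  let b := stdOrthonormalBasis ℝ E
  have h : ∀ x : E, ENNReal.ofReal (‖x‖ ^ 2) = ∑ i, ENNReal.ofReal (⟪b i, x⟫ ^ 2) := by
    intro x
    rw [← ENNReal.ofReal_sum_of_nonneg fun i _ => sq_nonneg _, ← b.sum_sq_norm_inner_right x]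
    simp
  simp_rw [h]
  rw [lintegral_finsetSum _ fun i _ => by fun_prop]
  simp [lintegral_inner_sq_stdGaussian]

theorem stdGaussian_absolutelyContinuous : stdGaussian E ≪ (volume : Measure E) := by
  rw [stdGaussian_eq_withDensity]
  exact withDensity_absolutelyContinuous _ _

theorem ae_stdGaussian_ne_zero [Nontrivial E] : ∀ᵐ x ∂stdGaussian E, x ≠ 0 :=
  stdGaussian_absolutelyContinuous.ae_le (Measure.ae_ne volume 0)

/-- The ellipse through two independent Gaussian vectors almost surely avoids the origin,
because the two vectors are almost surely linearly independent. -/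
theorem ae_forall_cos_smul_add_sin_smul_ne_zero (hE : 2 ≤ Module.finrank ℝ E) :
    ∀ᵐ p ∂(stdGaussian E).prod (stdGaussian E),
      ∀ θ : ℝ, Real.cos θ • p.1 + Real.sin θ • p.2 ≠ 0 := by
  have : Nontrivial E := Module.nontrivial_of_finrank_pos (R := ℝ) (by omega)
  have hS : MeasurableSet {p : E × E | ⟪p.1, p.2⟫ ^ 2 = ‖p.1‖ ^ 2 * ‖p.2‖ ^ 2} :=
    measurableSet_eq_fun (by fun_prop) (by fun_prop)
  have hnull : (stdGaussian E).prod (stdGaussian E)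
      {p : E × E | ⟪p.1, p.2⟫ ^ 2 = ‖p.1‖ ^ 2 * ‖p.2‖ ^ 2} = 0 := by
    rw [Measure.measure_prod_null hS]
    filter_upwards [ae_stdGaussian_ne_zero] with x hx
    refine stdGaussian_absolutelyContinuous (measure_mono_null (t := (ℝ ∙ x : Submodule ℝ E))
      (fun y hy => ?_) (Measure.addHaar_submodule _ _ fun h => ?_))
    · simp only [Set.mem_preimage, Set.mem_ofPred_eq] at hy
      have hx' : ‖x‖ ≠ 0 := norm_ne_zero_iff.2 hx
      have hn : ‖y - (⟪x, y⟫ / ‖x‖ ^ 2) • x‖ ^ 2 = 0 := by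
        rw [norm_sub_sq_real, inner_smul_right, norm_smul, mul_pow, Real.norm_eq_abs, sq_abs,
          real_inner_comm x y, div_pow]
        field_simp
        linarith
      have : y = (⟪x, y⟫ / ‖x‖ ^ 2) • x := by
        simpa [sub_eq_zero] using hn
      rw [this]
      exact Submodule.smul_mem _ _ (Submodule.mem_span_singleton_self x)
    · have h1 := finrank_span_singleton (K := ℝ) hx
      rw [h, finrank_top] at h1
      omega
  filter_upwards [measure_eq_zero_iff_ae_notMem.1 hnull] with p hp θ h
  refine hp ?_
  have e1 : Real.cos θ • p.1 = -(Real.sin θ • p.2) := eq_neg_of_add_eq_zero_left h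
  by_cases hs : Real.sin θ = 0
  · have hc : Real.cos θ ≠ 0 := fun hc => by
      have := Real.sin_sq_add_cos_sq θ
      simp [hs, hc] at this
    have : p.1 = 0 := by simpa [hs, hc] using e1
    simp [this]
  · have e2 : p.2 = (-(Real.cos θ / Real.sin θ)) • p.1 := by
      rw [neg_smul, div_eq_inv_mul, mul_smul, e1, smul_neg, smul_smul, inv_mul_cancel₀ hs]
      simp
    simp only [e2, inner_smul_right, real_inner_self_eq_norm_sq, norm_smul,
      Real.norm_eq_abs, mul_pow, sq_abs]
    ring

/-! ### The Poincaré inequality for odd functions in Gaussian space -/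

/-- The Gaussian Poincaré inequality with its sharp constant, for odd functions that are allowed to
be singular at the origin. For independent Gaussian vectors `X`, `Y`, the curve
`θ ↦ Φ (cos θ • X + sin θ • Y)` is antiperiodic because `Φ` is odd, so Wirtinger's inequality
applies to it; since rotations preserve the law of `(X, Y)`, averaging gives
`E[Φ(X)²] ≤ E[⟪G(X), Y⟫²] = E[‖G(X)‖²]`. -/
theorem lintegral_sq_le_lintegral_gradient_sq_stdGaussian (hE : 2 ≤ Module.finrank ℝ E)
    {Φ : E → ℝ} {G : E → E} (hodd : ∀ u, Φ (-u) = -Φ u) (hΦ : Measurable Φ) (hG : Measurable G)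
    (hgrad : ∀ u ≠ 0, HasGradientAt Φ (G u) u) (hcont : ContinuousOn G {0}ᶜ) :
    ∫⁻ u, ENNReal.ofReal (Φ u ^ 2) ∂stdGaussian E ≤
      ∫⁻ u, ENNReal.ofReal (‖G u‖ ^ 2) ∂stdGaussian E := by
  set γ := stdGaussian E
  set I : Measure ℝ := volume.restrict (Set.Ioc 0 (2 * Real.pi))
  have hrot : ∀ {H : E × E → ℝ≥0∞}, Measurable H → ∀ θ,
      ∫⁻ p, H (ContinuousLinearMap.rotation θ p) ∂γ.prod γ = ∫⁻ p, H p ∂γ.prod γ := by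
    intro H hH θ
    rw [← lintegral_map hH (by fun_prop), IsGaussian.map_rotation_eq_self integral_id_stdGaussian]
  have hI0 : I Set.univ ≠ 0 := by simp [I, Real.pi_pos]
  have hIt : I Set.univ ≠ ⊤ := measure_ne_top _ _
  have hrotm : Measurable fun q : (E × E) × ℝ => ContinuousLinearMap.rotation q.2 q.1 := by
    simp only [ContinuousLinearMap.rotation_apply]
    fun_prop
  have hswap : ∀ {H : E × E → ℝ≥0∞}, Measurable H →
      ∫⁻ p, ∫⁻ θ, H (ContinuousLinearMap.rotation θ p) ∂I ∂γ.prod γ =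
        (∫⁻ p, H p ∂γ.prod γ) * I Set.univ := by
    intro H hH
    have hHm : Measurable (Function.uncurry fun (p : E × E) (θ : ℝ) =>
        H (ContinuousLinearMap.rotation θ p)) := hH.comp hrotm
    rw [lintegral_lintegral_swap hHm.aemeasurable]
    simp [hrot hH]
  have hmain : ∫⁻ p, ENNReal.ofReal (Φ p.1 ^ 2) ∂γ.prod γ ≤
      ∫⁻ p, ENNReal.ofReal (⟪G p.1, p.2⟫ ^ 2) ∂γ.prod γ := by
    -- Both sides, times `2π`, are integrals over `θ` of the rotated integrands.
    refine (ENNReal.mul_le_mul_iff_left hI0 hIt).1 ?_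
    rw [← hswap (H := fun p => ENNReal.ofReal (Φ p.1 ^ 2)) (by fun_prop),
      ← hswap (H := fun p => ENNReal.ofReal (⟪G p.1, p.2⟫ ^ 2)) (by fun_prop)]
    refine lintegral_mono_ae ?_
    filter_upwards [ae_forall_cos_smul_add_sin_smul_ne_zero hE] with p hp
    simp only [ContinuousLinearMap.rotation_apply]
    set u : ℝ → E := fun θ => Real.cos θ • p.1 + Real.sin θ • p.2 with hu
    set u' : ℝ → E := fun θ => -Real.sin θ • p.1 + Real.cos θ • p.2 with hu'
    have hud : ∀ θ, HasDerivAt u (u' θ) θ := fun θ =>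
      ((Real.hasDerivAt_cos θ).smul_const p.1).add ((Real.hasDerivAt_sin θ).smul_const p.2)
    have hd : ∀ θ, HasDerivAt (fun θ => Φ (u θ)) ⟪G (u θ), u' θ⟫ θ := fun θ => by
      exact (hgrad _ (hp θ)).hasFDerivAt.comp_hasDerivAt θ (hud θ)
    have hc' : Continuous fun θ => ⟪G (u θ), u' θ⟫ := by
      have h1 : Continuous fun θ => G (u θ) :=
        hcont.comp_continuous (by fun_prop) hp
      have h2 : Continuous u' := by fun_prop
      exact h1.inner h2
    have hc : Continuous fun θ => Φ (u θ) :=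
      continuous_iff_continuousAt.2 fun θ => (hd θ).continuousAt
    have hW := integral_sq_le_integral_deriv_sq_of_antiperiodic hd hc' fun θ => by
      rw [← hodd]
      congr 1
      simp only [hu, Real.cos_add_pi, Real.sin_add_pi]
      module
    have h2pi : (0 : ℝ) ≤ 2 * Real.pi := by positivity
    have hconv : ∀ {g : ℝ → ℝ}, Continuous g → ∫⁻ θ, ENNReal.ofReal (g θ ^ 2) ∂I =
        ENNReal.ofReal (∫ θ in (0 : ℝ)..2 * Real.pi, g θ ^ 2) := by
      intro g hg
      rw [intervalIntegral.integral_of_le h2pi, ofReal_integral_eq_lintegral_ofReal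
        (f := fun θ => g θ ^ 2)
        (Continuous.integrableOn_Ioc (f := fun θ => g θ ^ 2) (by fun_prop))
        (.of_forall fun _ => sq_nonneg _)]
    rw [hconv hc, hconv hc']
    exact ENNReal.ofReal_le_ofReal hW
  rw [lintegral_prod _ (by fun_prop), lintegral_prod _ (by fun_prop)] at hmain
  simpa [lintegral_inner_sq_stdGaussian, γ] using hmain

end GaussianMeasure

/-! ### The Poincaré inequality for odd functions on the sphere -/

theorem continuous_gradient {E : Type*} [NormedAddCommGroup E] [InnerProductSpace ℝ E]
    [CompleteSpace E] {F : E → ℝ} (hF : ContDiff ℝ 1 F) : Continuous (gradient F) :=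
  (InnerProductSpace.toDual ℝ E).symm.continuous.comp (hF.continuous_fderiv one_ne_zero)

/-- The gradient of the extension of `F` from the unit sphere that is homogeneous of degree one. -/
theorem hasGradientAt_norm_mul_comp_normalize {E : Type*} [NormedAddCommGroup E]
    [InnerProductSpace ℝ E] [CompleteSpace E] {F : E → ℝ} (hF : ContDiff ℝ 1 F) {u : E}
    (hu : u ≠ 0) :
    HasGradientAt (fun u => ‖u‖ * F (‖u‖⁻¹ • u))
      ((F (‖u‖⁻¹ • u) - ⟪gradient F (‖u‖⁻¹ • u), ‖u‖⁻¹ • u⟫) • (‖u‖⁻¹ • u)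
        + gradient F (‖u‖⁻¹ • u)) u := by
  have hn : ‖u‖ ≠ 0 := norm_ne_zero_iff.2 hu
  have h1 : HasFDerivAt (fun u : E => ‖u‖) (‖u‖⁻¹ • innerSL ℝ u) u := by
    have := (hasStrictFDerivAt_norm_sq u).hasFDerivAt.sqrt (by positivity)
    simp only [Real.sqrt_sq (norm_nonneg _)] at this
    convert! this using 1
    ext w
    simp
    field_simp
  have h2 : HasFDerivAt (fun u : E => ‖u‖⁻¹ • u) (‖u‖⁻¹ • ContinuousLinearMap.id ℝ E +
      (-(‖u‖ ^ 2)⁻¹ • ‖u‖⁻¹ • innerSL ℝ u).smulRight u) u :=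
    ((hasDerivAt_inv hn).comp_hasFDerivAt u h1).smul (hasFDerivAt_id u)
  have h3 := ((hF.differentiable one_ne_zero) (‖u‖⁻¹ • u)).hasGradientAt.hasFDerivAt.comp
    (f := fun u : E => ‖u‖⁻¹ • u) u h2
  have h4 := h1.mul h3
  rw [hasGradientAt_iff_hasFDerivAt]
  convert! h4 using 1
  ext w
  simp [inner_smul_right]
  field_simp
  ring

/-- The Poincaré inequality for odd functions on the unit sphere, with the constant `dim - 1`.
The extension of `F` homogeneous of degree one, `u ↦ ‖u‖ F(u / ‖u‖)`, has squared norm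
`dim * ∫ F²` in the Gaussian space, and the square of its gradient at `u` is at most
`F² + ‖∇F‖²` at `u / ‖u‖`; the Gaussian Poincaré inequality for it is the claim after cancelling one
copy of `∫ F²`. -/
theorem sub_one_mul_lintegral_sq_le_lintegral_gradient_sq {E : Type*}
    [NormedAddCommGroup E] [InnerProductSpace ℝ E] [FiniteDimensional ℝ E] [MeasurableSpace E]
    [BorelSpace E] (hE : 2 ≤ Module.finrank ℝ E) {F : E → ℝ} (hF : ContDiff ℝ 1 F)
    (hodd : ∀ u, F (-u) = -F u) :
    ((Module.finrank ℝ E - 1 : ℕ) : ℝ≥0∞) *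
      ∫⁻ u, ENNReal.ofReal (F u ^ 2)
        ∂(cond (volume : Measure E).toSphere Set.univ).map Subtype.val ≤
      ∫⁻ u, ENNReal.ofReal (‖gradient F u‖ ^ 2)
        ∂(cond (volume : Measure E).toSphere Set.univ).map Subtype.val := by
  have : Nontrivial E := Module.nontrivial_of_finrank_pos (R := ℝ) (by omega)
  have hgc : Continuous (gradient F) := continuous_gradient hF
  have hFc := hF.continuous
  have hFm := hFc.measurable
  have hgm := hgc.measurable
  set σ := (cond (volume : Measure E).toSphere Set.univ).map Subtype.val with hσ
  set G : E → E := fun u => (F (‖u‖⁻¹ • u) - ⟪gradient F (‖u‖⁻¹ • u), ‖u‖⁻¹ • u⟫) • (‖u‖⁻¹ • u)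
        + gradient F (‖u‖⁻¹ • u) with hGdef
  have hcone := lintegral_sq_le_lintegral_gradient_sq_stdGaussian hE
    (Φ := fun u => ‖u‖ * F (‖u‖⁻¹ • u)) (G := G) (fun u => by simp [hodd]) (by fun_prop)
    (by fun_prop) (fun u hu => hasGradientAt_norm_mul_comp_normalize hF hu) (by
      have hv : ContinuousOn (fun u : E => ‖u‖⁻¹ • u) {0}ᶜ :=
        (continuous_norm.continuousOn.inv₀ fun u hu => norm_ne_zero_iff.2 hu).smul continuousOn_id
      have h1 := hFc.comp_continuousOn hv
      have h2 := hgc.comp_continuousOn hv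
      exact ((h1.sub (h2.inner hv)).smul hv).add h2)
  have hl : ∫⁻ u, ENNReal.ofReal ((‖u‖ * F (‖u‖⁻¹ • u)) ^ 2) ∂stdGaussian E =
      (Module.finrank ℝ E : ℝ≥0∞) * ∫⁻ u, ENNReal.ofReal (F u ^ 2) ∂σ := by
    have := lintegral_stdGaussian_polar (E := E) (A := fun u => ENNReal.ofReal (F u ^ 2))
      (B := fun r => ENNReal.ofReal (r ^ 2)) (by fun_prop) (by fun_prop)
    rw [lintegral_norm_sq_stdGaussian] at this
    rw [mul_comm, ← this]
    refine lintegral_congr fun u => ?_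
    rw [← ENNReal.ofReal_mul (sq_nonneg _)]
    congr 1
    ring
  have hr : ∫⁻ u, ENNReal.ofReal (‖G u‖ ^ 2) ∂stdGaussian E ≤
      ∫⁻ u, ENNReal.ofReal (F u ^ 2) ∂σ + ∫⁻ u, ENNReal.ofReal (‖gradient F u‖ ^ 2) ∂σ := by
    have := lintegral_stdGaussian_polar (E := E)
      (A := fun u => ENNReal.ofReal (F u ^ 2) + ENNReal.ofReal (‖gradient F u‖ ^ 2))
      (B := fun _ => 1) (by fun_prop) (by fun_prop)
    simp only [mul_one, lintegral_one, measure_univ] at this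
    rw [← lintegral_add_left (by fun_prop), ← this]
    refine lintegral_mono_ae ?_
    filter_upwards [ae_stdGaussian_ne_zero] with u hu
    rw [← ENNReal.ofReal_add (sq_nonneg _) (sq_nonneg _)]
    refine ENNReal.ofReal_le_ofReal ?_
    have hv : ‖‖u‖⁻¹ • u‖ = 1 := norm_smul_inv_norm (𝕜 := ℝ) hu
    simp only [hGdef]
    generalize ‖u‖⁻¹ • u = v at hv
    rw [norm_add_sq_real, norm_smul, hv, inner_smul_left, mul_one,
      Real.norm_eq_abs, sq_abs]
    simp only [conj_trivial]
    rw [real_inner_comm v (gradient F v)]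
    nlinarith [sq_nonneg ⟪v, gradient F v⟫]
  -- Finiteness of `∫ F²` is what allows it to be cancelled.
  have hfin : ∫⁻ u, ENNReal.ofReal (F u ^ 2) ∂σ ≠ ⊤ := by
    obtain ⟨C, hC⟩ := (isCompact_sphere (0 : E) 1).exists_bound_of_continuousOn
      hFc.continuousOn
    rw [hσ, lintegral_map (by fun_prop) measurable_subtype_coe]
    have : IsFiniteMeasure (cond (volume : Measure E).toSphere Set.univ) :=
      inferInstance
    refine ne_top_of_le_ne_top (b := ∫⁻ _, ENNReal.ofReal (C ^ 2)
      ∂(cond (volume : Measure E).toSphere Set.univ)) ?_ (lintegral_mono fun u => ?_)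
    · rw [lintegral_const]
      exact ENNReal.mul_ne_top ENNReal.ofReal_ne_top (measure_ne_top _ _)
    · refine ENNReal.ofReal_le_ofReal (sq_le_sq' ?_ ?_)
      · exact (abs_le.1 (hC u u.2)).1
      · exact (abs_le.1 (hC u u.2)).2
  rw [hl] at hcone
  have h := hcone.trans hr
  obtain ⟨n, hn⟩ : ∃ n, Module.finrank ℝ E = n + 1 := ⟨_, (Nat.sub_add_cancel (by omega)).symm⟩
  rw [hn] at h ⊢
  rw [Nat.add_sub_cancel]
  push_cast at h
  rw [add_mul, one_mul, add_comm] at h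
  exact (ENNReal.add_le_add_iff_left hfin).1 h

/-! ### Symmetric differences of functions with Lipschitz gradient -/

theorem hasGradientAt_symmetric_difference {E : Type*} [NormedAddCommGroup E]
    [InnerProductSpace ℝ E] [CompleteSpace E] {f : E → ℝ} (hf : ContDiff ℝ 1 f) (x u : E) (ρ : ℝ) :
    HasGradientAt (fun u => f (x + ρ • u) - f (x - ρ • u))
      (ρ • (gradient f (x + ρ • u) + gradient f (x - ρ • u))) u := by
  have hd := hf.differentiable one_ne_zero
  have h0 : HasFDerivAt (fun u : E => ρ • u) (ρ • ContinuousLinearMap.id ℝ E) u :=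
    (hasFDerivAt_id u).const_smul ρ
  have h1 := (hd (x + ρ • u)).hasGradientAt.hasFDerivAt.comp
    (f := fun u => x + ρ • u) u (h0.const_add x)
  have h2 := (hd (x - ρ • u)).hasGradientAt.hasFDerivAt.comp
    (f := fun u => x - ρ • u) u (h0.const_sub x)
  rw [hasGradientAt_iff_hasFDerivAt]
  convert! h1.sub h2 using 1
  ext w
  simp

instance isProbabilityMeasure_uniformSphere (d : ℕ) [NeZero d] :
    IsProbabilityMeasure (uniformSphere d) := by
  have : Nontrivial (EuclideanSpace ℝ (Fin d)) :=
    Module.nontrivial_of_finrank_pos (R := ℝ) (by simpa using NeZero.pos d)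
  have : IsProbabilityMeasure
      (cond (volume : Measure (EuclideanSpace ℝ (Fin d))).toSphere Set.univ) :=
    cond_isProbabilityMeasure (Measure.measure_univ_ne_zero.2 (Measure.toSphere_ne_zero _))
  exact Measure.isProbabilityMeasure_map measurable_subtype_coe.aemeasurable

theorem ae_norm_eq_one_uniformSphere (d : ℕ) : ∀ᵐ u ∂uniformSphere d, ‖u‖ = 1 := by
  rw [uniformSphere, ae_map_iff measurable_subtype_coe.aemeasurable
    (measurableSet_eq_fun (by fun_prop) (by fun_prop))]
  exact .of_forall fun u => by simp

section HolderClass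

variable {d : ℕ} {L : ℝ} {f : EuclideanSpace ℝ (Fin d) → ℝ}

theorem strictFloor_two : strictFloor 2 = 1 := by
  simp [strictFloor]

theorem HolderClass.contDiff (hf : f ∈ HolderClass 2 L) : ContDiff ℝ 1 f := by
  simpa [strictFloor_two] using hf.1

theorem HolderClass.norm_gradient_sub_le (hf : f ∈ HolderClass 2 L)
    (x z : EuclideanSpace ℝ (Fin d)) : ‖gradient f x - gradient f z‖ ≤ L * ‖x - z‖ := by
  have h := hf.2 x z
  rw [strictFloor_two] at h
  norm_num at h
  rw [gradient, gradient, ← map_sub, LinearIsometryEquiv.norm_map]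
  refine ContinuousLinearMap.opNorm_le_bound _ ((norm_nonneg _).trans h) fun v => ?_
  have h1 := (iteratedFDeriv ℝ 1 f x - iteratedFDeriv ℝ 1 f z).le_opNorm fun _ => v
  simp only [sub_apply, iteratedFDeriv_one_apply, Finset.univ_unique, Finset.prod_singleton] at h1
  exact h1.trans (by gcongr)

theorem HolderClass.norm_gradient_le (hf : f ∈ HolderClass 2 L)
    (x z : EuclideanSpace ℝ (Fin d)) : ‖gradient f (x + z)‖ ≤ ‖gradient f x‖ + L * ‖z‖ := by
  have h1 := HolderClass.norm_gradient_sub_le hf (x + z) x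
  have h2 := norm_sub_norm_le (gradient f (x + z)) (gradient f x)
  rw [add_sub_cancel_left] at h1
  linarith

/-- The Poincaré inequality on the sphere, applied to the odd function
`u ↦ f (x + ρ • u) - f (x - ρ • u)`, whose gradient on the sphere is bounded by
`2 h (‖∇f(x)‖ + L h)`. -/
theorem HolderClass.lintegral_symmetric_difference_sq_le (hd : 2 ≤ d) (hL : 0 ≤ L)
    (hf : f ∈ HolderClass 2 L) (x : EuclideanSpace ℝ (Fin d)) {ρ h : ℝ} (hρ : |ρ| ≤ h) :
    ∫⁻ u, ENNReal.ofReal ((f (x + ρ • u) - f (x - ρ • u)) ^ 2) ∂uniformSphere d ≤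
      ENNReal.ofReal (4 * h ^ 2 / (d - 1)) * ENNReal.ofReal ((‖gradient f x‖ + L * h) ^ 2) := by
  have : NeZero d := ⟨by omega⟩
  have hd' : (0 : ℝ) < d - 1 := by
    have : (2 : ℝ) ≤ d := by exact_mod_cast hd
    linarith
  have hC := HolderClass.contDiff hf
  have hh : 0 ≤ h := (abs_nonneg ρ).trans hρ
  have hP := sub_one_mul_lintegral_sq_le_lintegral_gradient_sq
    (E := EuclideanSpace ℝ (Fin d)) (by simpa using hd)
    (F := fun u => f (x + ρ • u) - f (x - ρ • u)) (by fun_prop) (fun u => by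
      simp only [smul_neg, sub_neg_eq_add, ← sub_eq_add_neg, neg_sub])
  have hb : ∫⁻ u, ENNReal.ofReal (‖gradient (fun u => f (x + ρ • u) - f (x - ρ • u)) u‖ ^ 2)
      ∂uniformSphere d ≤ ENNReal.ofReal ((2 * h * (‖gradient f x‖ + L * h)) ^ 2) := by
    calc _ ≤ ∫⁻ _, ENNReal.ofReal ((2 * h * (‖gradient f x‖ + L * h)) ^ 2) ∂uniformSphere d := by
          refine lintegral_mono_ae ?_
          filter_upwards [ae_norm_eq_one_uniformSphere d] with u hu
          refine ENNReal.ofReal_le_ofReal ?_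
          rw [(hasGradientAt_symmetric_difference hC x u ρ).gradient, norm_smul, Real.norm_eq_abs]
          have h1 := HolderClass.norm_gradient_le hf x (ρ • u)
          have h2 := HolderClass.norm_gradient_le hf x (-(ρ • u))
          rw [norm_neg] at h2
          rw [← sub_eq_add_neg] at h2
          have hn : ‖ρ • u‖ ≤ h := by rwa [norm_smul, hu, mul_one]
          have hn' : L * ‖ρ • u‖ ≤ L * h := by gcongr
          have h3 : ‖gradient f (x + ρ • u) + gradient f (x - ρ • u)‖ ≤
              2 * (‖gradient f x‖ + L * h) := (norm_add_le _ _).trans (by linarith)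
          have h4 : |ρ| * ‖gradient f (x + ρ • u) + gradient f (x - ρ • u)‖ ≤
              h * (2 * (‖gradient f x‖ + L * h)) := by gcongr
          have h5 : |ρ| * ‖gradient f (x + ρ • u) + gradient f (x - ρ • u)‖ ≤
              2 * h * (‖gradient f x‖ + L * h) := by linarith
          gcongr
      _ = _ := by simp
  have hcast : ((Module.finrank ℝ (EuclideanSpace ℝ (Fin d)) - 1 : ℕ) : ℝ≥0∞) =
      ENNReal.ofReal (d - 1) := by
    rw [finrank_euclideanSpace_fin, ← ENNReal.ofReal_natCast, Nat.cast_sub (by omega)]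
    simp
  rw [hcast] at hP
  have hmain := hP.trans hb
  refine (ENNReal.mul_le_mul_iff_right (a := ENNReal.ofReal ((d : ℝ) - 1)) (by simpa using hd')
    ENNReal.ofReal_ne_top).1 (hmain.trans (le_of_eq ?_))
  rw [← ENNReal.ofReal_mul (by positivity), ← ENNReal.ofReal_mul hd'.le]
  congr 1
  field_simp
  ring

end HolderClass

/-! ### The law of the radius and the independence of the noise -/

theorem isProbabilityMeasure_uniformInterval : IsProbabilityMeasure uniformInterval :=
  cond_isProbabilityMeasure_of_finite (by simp) (by simp)

theorem uniformInterval_eq : uniformInterval =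
    (2 : ℝ≥0∞)⁻¹ • (volume : Measure ℝ).restrict (Set.Icc (-1) 1) := by
  rw [uniformInterval, ProbabilityTheory.cond, Real.volume_Icc]
  norm_num

theorem lintegral_sq_uniformInterval (K : ℝ → ℝ) :
    ∫⁻ r, ENNReal.ofReal (K r ^ 2) ∂uniformInterval = 2⁻¹ * kappa K := by
  rw [uniformInterval_eq, lintegral_smul_measure, kappa, smul_eq_mul]

/-- Independence of `X` and `Y` given `Z` becomes plain independence when `Y` is independent
of `Z`: the conditional probabilities of `Y` are then constant. -/
theorem CondIndepGiven.indepFun {Ω A B C : Type*} [MeasurableSpace Ω] [MeasurableSpace A]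
    [MeasurableSpace B] [mC : MeasurableSpace C] {P : Measure Ω} [IsProbabilityMeasure P]
    {Z : Ω → C} {X : Ω → A} {Y : Ω → B} (hX : Measurable X) (hY : Measurable Y)
    (hZ : Measurable Z) (h : CondIndepGiven P Z X Y) (hYZ : IndepFun Y Z P) : IndepFun X Y P := by
  rw [indepFun_iff_measure_inter_preimage_eq_mul]
  intro s t hs ht
  have hle : mC.comap Z ≤ ‹MeasurableSpace Ω› := hZ.comap_le
  have hconst : P⟦Y ⁻¹' t | mC.comap Z⟧ =ᵐ[P] fun _ => P.real (Y ⁻¹' t) := by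
    have := condExp_indep_eq (μ := P) (f := (Y ⁻¹' t).indicator fun _ => (1 : ℝ))
      hY.comap_le hle
      (stronglyMeasurable_const.indicator (s := Y ⁻¹' t) ⟨t, ht, rfl⟩) hYZ
    rwa [integral_indicator_const _ (hY ht), smul_eq_mul, mul_one] at this
  have hint : ∀ {S : Set Ω}, MeasurableSet S → ∫ ω, (P⟦S | mC.comap Z⟧) ω ∂P = P.real S := by
    intro S hS
    rw [integral_condExp hle, integral_indicator_const _ hS, smul_eq_mul, mul_one]
  have hreal : P.real (X ⁻¹' s ∩ Y ⁻¹' t) = P.real (X ⁻¹' s) * P.real (Y ⁻¹' t) := by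
    rw [← hint ((hX hs).inter (hY ht)), ← hint (hX hs), ← integral_mul_const]
    refine integral_congr_ae ?_
    filter_upwards [h s t hs ht, hconst] with ω h1 h2
    rw [h1, h2]
  rw [measureReal_def, measureReal_def, measureReal_def, ← ENNReal.toReal_mul] at hreal
  exact (ENNReal.toReal_eq_toReal_iff' (measure_ne_top _ _)
    (ENNReal.mul_ne_top (measure_ne_top _ _) (measure_ne_top _ _))).1 hreal

/-! ### The second moment of the gradient estimator -/

/-- A bound without cross terms between the difference of function values and the noises, so that
no joint independence of noise, direction and radius is needed later. -/
theorem norm_sq_gradEstimator_le {d : ℕ} {f : EuclideanSpace ℝ (Fin d) → ℝ} {K : ℝ → ℝ} {h : ℝ}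
    {x ζ : EuclideanSpace ℝ (Fin d)} {r ξ ξ' : ℝ} (hζ : ‖ζ‖ = 1) :
    ‖gradEstimator f K h x ζ r ξ ξ'‖ ^ 2 ≤
      (d : ℝ) ^ 2 / (2 * h ^ 2) * ((f (x + (h * r) • ζ) - f (x - (h * r) • ζ)) ^ 2 * K r ^ 2) +
        (d : ℝ) ^ 2 / h ^ 2 * (ξ ^ 2 * K r ^ 2 + ξ' ^ 2 * K r ^ 2) := by
  rw [gradEstimator, norm_smul, hζ, mul_one, Real.norm_eq_abs, sq_abs]
  set D := f (x + (h * r) • ζ) - f (x - (h * r) • ζ)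
  have hD : (f (x + (h * r) • ζ) + ξ) - (f (x - (h * r) • ζ) + ξ') = D + (ξ - ξ') := by ring
  rw [hD]
  have hsq : (D + (ξ - ξ')) ^ 2 ≤ 2 * D ^ 2 + 4 * (ξ ^ 2 + ξ' ^ 2) := by
    nlinarith [sq_nonneg (D - (ξ - ξ')), sq_nonneg (ξ + ξ')]
  calc _ = ((d : ℝ) / (2 * h)) ^ 2 * K r ^ 2 * (D + (ξ - ξ')) ^ 2 := by ring
    _ ≤ ((d : ℝ) / (2 * h)) ^ 2 * K r ^ 2 * (2 * D ^ 2 + 4 * (ξ ^ 2 + ξ' ^ 2)) := by gcongr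
    _ = _ := by
      by_cases hh : h = 0
      · simp [hh]
      · field_simp
        ring

theorem lintegral_noise_sq_mul_le {Ω : Type*} [MeasurableSpace Ω] {P : Measure Ω}
    {σ : ℝ} {r ξ : Ω → ℝ} {K : ℝ → ℝ} (hK : Measurable K) (hξ : Measurable ξ) (hr : Measurable r)
    (hlaw : HasLaw r uniformInterval P) (hind : IndepFun ξ r P)
    (hmom : ∫⁻ ω, ENNReal.ofReal (ξ ω ^ 2) ∂P ≤ ENNReal.ofReal (σ ^ 2)) :
    ∫⁻ ω, ENNReal.ofReal (ξ ω ^ 2 * K (r ω) ^ 2) ∂P ≤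
      ENNReal.ofReal (σ ^ 2) * (2⁻¹ * kappa K) := by
  simp_rw [ENNReal.ofReal_mul (sq_nonneg _)]
  have h1 := lintegral_mul_eq_lintegral_mul_lintegral_of_indepFun
    (f := fun ω => ENNReal.ofReal (ξ ω ^ 2)) (g := fun ω => ENNReal.ofReal (K (r ω) ^ 2)) (μ := P)
    (by fun_prop) (by fun_prop)
    (hind.comp (φ := fun y => ENNReal.ofReal (y ^ 2)) (ψ := fun y => ENNReal.ofReal (K y ^ 2))
      (by fun_prop) (by fun_prop))
  have h2 := hlaw.lintegral_comp (f := fun y => ENNReal.ofReal (K y ^ 2)) (by fun_prop)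
  simp only [Pi.mul_apply] at h1
  rw [h1, h2, lintegral_sq_uniformInterval]
  gcongr

theorem lintegral_symmetric_difference_sq_mul_le {Ω : Type*} [MeasurableSpace Ω] {P : Measure Ω}
    [IsProbabilityMeasure P] {d : ℕ} (hd : 2 ≤ d) {L h : ℝ} (hL : 0 ≤ L) (hh : 0 ≤ h)
    {f : EuclideanSpace ℝ (Fin d) → ℝ} (hf : f ∈ HolderClass 2 L) {K : ℝ → ℝ} (hK : Measurable K)
    {x ζ : Ω → EuclideanSpace ℝ (Fin d)} {r : Ω → ℝ} (hx : Measurable x) (hζ : Measurable ζ)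
    (hr : Measurable r) (hlawζ : HasLaw ζ (uniformSphere d) P) (hlawr : HasLaw r uniformInterval P)
    (hfresh : IndepFun (fun ω => (ζ ω, r ω)) x P) (hζr : IndepFun ζ r P) :
    ∫⁻ ω, ENNReal.ofReal ((f (x ω + (h * r ω) • ζ ω) - f (x ω - (h * r ω) • ζ ω)) ^ 2 *
        K (r ω) ^ 2) ∂P ≤
      ENNReal.ofReal (4 * h ^ 2 / (d - 1)) *
        (∫⁻ ω, ENNReal.ofReal ((‖gradient f (x ω)‖ + L * h) ^ 2) ∂P) * (2⁻¹ * kappa K) := by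
  have : NeZero d := ⟨by omega⟩
  have := isProbabilityMeasure_uniformInterval
  have hfm : Measurable f := (HolderClass.contDiff hf).continuous.measurable
  have hgm : Measurable (gradient f) := (continuous_gradient (HolderClass.contDiff hf)).measurable
  have hlaw : P.map (fun ω => ((ζ ω, r ω), x ω)) =
      ((uniformSphere d).prod uniformInterval).prod (P.map x) := by
    rw [(indepFun_iff_map_prod_eq_prod_map_map (by fun_prop) (by fun_prop)).1 hfresh,
      (indepFun_iff_map_prod_eq_prod_map_map (by fun_prop) (by fun_prop)).1 hζr,
      hlawζ.map_eq, hlawr.map_eq]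
  have := Measure.isProbabilityMeasure_map (μ := P) hx.aemeasurable
  set H : (EuclideanSpace ℝ (Fin d) × ℝ) × EuclideanSpace ℝ (Fin d) → ℝ≥0∞ := fun p =>
    ENNReal.ofReal ((f (p.2 + (h * p.1.2) • p.1.1) - f (p.2 - (h * p.1.2) • p.1.1)) ^ 2 *
      K p.1.2 ^ 2) with hH
  have hHm : Measurable H := by fun_prop
  have hr1 : ∀ᵐ s ∂uniformInterval, |s| ≤ 1 := by
    rw [uniformInterval_eq]
    refine Measure.ae_smul_measure ?_ _
    filter_upwards [ae_restrict_mem measurableSet_Icc] with s hs using abs_le.2 hs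
  have hxi : ∫⁻ y, ENNReal.ofReal ((‖gradient f y‖ + L * h) ^ 2) ∂P.map x =
      ∫⁻ ω, ENNReal.ofReal ((‖gradient f (x ω)‖ + L * h) ^ 2) ∂P :=
    lintegral_map (by fun_prop) hx
  calc _ = ∫⁻ p, H p ∂P.map (fun ω => ((ζ ω, r ω), x ω)) :=
        (lintegral_map hHm (by fun_prop)).symm
    _ = ∫⁻ y, ∫⁻ s, ∫⁻ u, H ((u, s), y) ∂uniformSphere d ∂uniformInterval ∂P.map x := by
        rw [hlaw, lintegral_prod_symm' _ hHm]
        refine lintegral_congr fun y => ?_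
        rw [lintegral_prod_symm' _ (by fun_prop)]
    _ ≤ ∫⁻ y, ∫⁻ s, ENNReal.ofReal (4 * h ^ 2 / (d - 1)) *
          ENNReal.ofReal ((‖gradient f y‖ + L * h) ^ 2) * ENNReal.ofReal (K s ^ 2)
          ∂uniformInterval ∂P.map x := by
        refine lintegral_mono fun y => lintegral_mono_ae ?_
        filter_upwards [hr1] with s hs
        have hρ : |h * s| ≤ h := by
          rw [abs_mul, abs_of_nonneg hh]
          exact mul_le_of_le_one_right hh hs
        simp only [hH, ENNReal.ofReal_mul (sq_nonneg _)]
        rw [lintegral_mul_const _ (by fun_prop)]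
        gcongr
        exact HolderClass.lintegral_symmetric_difference_sq_le hd hL hf y hρ
    _ = _ := by
        have hm : ∀ y : EuclideanSpace ℝ (Fin d),
            ∫⁻ s, ENNReal.ofReal (4 * h ^ 2 / (d - 1)) *
              ENNReal.ofReal ((‖gradient f y‖ + L * h) ^ 2) * ENNReal.ofReal (K s ^ 2)
              ∂uniformInterval = ENNReal.ofReal (4 * h ^ 2 / (d - 1)) *
              ENNReal.ofReal ((‖gradient f y‖ + L * h) ^ 2) * (2⁻¹ * kappa K) := fun y => by
          rw [lintegral_const_mul _ (by fun_prop), lintegral_sq_uniformInterval]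
        simp_rw [hm]
        rw [lintegral_mul_const _ (by fun_prop), lintegral_const_mul _ (by fun_prop), hxi]

theorem lintegral_norm_sq_gradEstimator_le {Ω : Type*} [MeasurableSpace Ω] {P : Measure Ω}
    [IsProbabilityMeasure P] {d : ℕ} (hd : 2 ≤ d) {L : ℝ} (hL : 0 ≤ L)
    {f : EuclideanSpace ℝ (Fin d) → ℝ} (hf : f ∈ HolderClass 2 L)
    {K : ℝ → ℝ} (hK : AEMeasurable K (volume.restrict (Set.Icc (-1 : ℝ) 1)))
    {Θ : Set (EuclideanSpace ℝ (Fin d))} {η h : ℕ → ℝ} {T : ℕ}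
    {x ζ : ℕ → Ω → EuclideanSpace ℝ (Fin d)} {r ξ ξ' : ℕ → Ω → ℝ} {σ : ℝ}
    (hrun : IsSphereRun P f K Θ η h T x ζ r ξ ξ')
    (hnoise : NoiseAssumption P σ T x ζ r ξ ξ') {t : ℕ} (ht : t ∈ Finset.Icc 1 T) :
    ∫⁻ ω, ENNReal.ofReal (‖gradEstimator f K (h t) (x t ω) (ζ t ω) (r t ω)
          (ξ t ω) (ξ' t ω)‖ ^ 2) ∂P
      ≤ ENNReal.ofReal ((d : ℝ) ^ 2 / ((d : ℝ) - 1)) * kappa K *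
          ∫⁻ ω, ENNReal.ofReal ((‖gradient f (x t ω)‖ + L * h t) ^ 2) ∂P
        + ENNReal.ofReal ((d : ℝ) ^ 2 * σ ^ 2 / h t ^ 2) * kappa K := by
  have hd' : (0 : ℝ) < d - 1 := by
    have : (2 : ℝ) ≤ d := by exact_mod_cast hd
    linarith
  have hx := hrun.measurable_x t ht
  have hζ := hrun.measurable_zeta t ht
  have hr := hrun.measurable_r t ht
  have hξ := hrun.measurable_xi t ht
  have hξ' := hrun.measurable_xi' t ht
  have hh := hrun.h_pos t ht
  have hrx : IndepFun (r t) (x t) P := (hrun.fresh t ht).comp measurable_snd measurable_id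
  have hfm : Measurable f := (HolderClass.contDiff hf).continuous.measurable
  have hKm := hK.measurable_mk
  have hkappa : kappa (hK.mk K) = kappa K := by
    refine lintegral_congr_ae ?_
    filter_upwards [hK.ae_eq_mk] with s hs
    rw [hs]
  -- `K` is only almost everywhere measurable on `[-1, 1]`, where `r t` lives.
  have hKae : ∀ᵐ ω ∂P, K (r t ω) = hK.mk K (r t ω) := by
    have h1 : ∀ᵐ s ∂P.map (r t), K s = hK.mk K s := by
      rw [(hrun.law_r t ht).map_eq, uniformInterval_eq]
      exact Measure.ae_smul_measure hK.ae_eq_mk _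
    exact ae_of_ae_map hr.aemeasurable h1
  have hζae : ∀ᵐ ω ∂P, ‖ζ t ω‖ = 1 := by
    refine ae_of_ae_map (p := fun u => ‖u‖ = 1) hζ.aemeasurable ?_
    rw [(hrun.law_zeta t ht).map_eq]
    exact ae_norm_eq_one_uniformSphere d
  have hN := lintegral_noise_sq_mul_le hKm hξ hr (hrun.law_r t ht)
    ((hnoise.xi_r t ht).indepFun hξ hr hx hrx) (hnoise.moment_xi t ht)
  have hN' := lintegral_noise_sq_mul_le hKm hξ' hr (hrun.law_r t ht)
    ((hnoise.xi'_r t ht).indepFun hξ' hr hx hrx) (hnoise.moment_xi' t ht)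
  have hD := lintegral_symmetric_difference_sq_mul_le hd hL hh.le hf hKm hx hζ hr
    (hrun.law_zeta t ht) (hrun.law_r t ht) (hrun.fresh t ht) (hnoise.zeta_r t ht)
  rw [hkappa] at hN hN' hD
  set k := hK.mk K
  set D : Ω → ℝ := fun ω => f (x t ω + (h t * r t ω) • ζ t ω) - f (x t ω - (h t * r t ω) • ζ t ω)
    with hDdef
  have hDm : Measurable D := by fun_prop
  set I := ∫⁻ ω, ENNReal.ofReal ((‖gradient f (x t ω)‖ + L * h t) ^ 2) ∂P
  have h2 : (2 : ℝ≥0∞)⁻¹ = ENNReal.ofReal (1 / 2) := by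
    rw [one_div, ENNReal.ofReal_inv_of_pos two_pos, ENNReal.ofReal_ofNat]
  calc _ ≤ ∫⁻ ω, (ENNReal.ofReal ((d : ℝ) ^ 2 / (2 * h t ^ 2)) *
          ENNReal.ofReal (D ω ^ 2 * k (r t ω) ^ 2) + ENNReal.ofReal ((d : ℝ) ^ 2 / h t ^ 2) *
          (ENNReal.ofReal (ξ t ω ^ 2 * k (r t ω) ^ 2) +
            ENNReal.ofReal (ξ' t ω ^ 2 * k (r t ω) ^ 2))) ∂P := by
        refine lintegral_mono_ae ?_
        filter_upwards [hKae, hζae] with ω hKω hζω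
        rw [← ENNReal.ofReal_add (by positivity) (by positivity),
          ← ENNReal.ofReal_mul (by positivity), ← ENNReal.ofReal_mul (by positivity),
          ← ENNReal.ofReal_add (by positivity) (by positivity)]
        refine ENNReal.ofReal_le_ofReal ((norm_sq_gradEstimator_le hζω).trans ?_)
        rw [hKω]
    _ = ENNReal.ofReal ((d : ℝ) ^ 2 / (2 * h t ^ 2)) *
          ∫⁻ ω, ENNReal.ofReal (D ω ^ 2 * k (r t ω) ^ 2) ∂P +
        ENNReal.ofReal ((d : ℝ) ^ 2 / h t ^ 2) *
          (∫⁻ ω, ENNReal.ofReal (ξ t ω ^ 2 * k (r t ω) ^ 2) ∂P +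
            ∫⁻ ω, ENNReal.ofReal (ξ' t ω ^ 2 * k (r t ω) ^ 2) ∂P) := by
        rw [lintegral_add_left (by fun_prop), lintegral_const_mul _ (by fun_prop),
          lintegral_const_mul _ (by fun_prop), lintegral_add_left (by fun_prop)]
    _ ≤ ENNReal.ofReal ((d : ℝ) ^ 2 / (2 * h t ^ 2)) *
          (ENNReal.ofReal (4 * h t ^ 2 / (d - 1)) * I * (2⁻¹ * kappa K)) +
        ENNReal.ofReal ((d : ℝ) ^ 2 / h t ^ 2) *
          (ENNReal.ofReal (σ ^ 2) * (2⁻¹ * kappa K) +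
            ENNReal.ofReal (σ ^ 2) * (2⁻¹ * kappa K)) := by
        gcongr
    _ = ENNReal.ofReal ((d : ℝ) ^ 2 / (2 * h t ^ 2)) *
          ENNReal.ofReal (4 * h t ^ 2 / (d - 1)) * 2⁻¹ * kappa K * I +
        ENNReal.ofReal ((d : ℝ) ^ 2 / h t ^ 2) * ENNReal.ofReal (σ ^ 2) * kappa K *
          (2⁻¹ + 2⁻¹) := by ring
    _ = _ := by
        have e1 : ENNReal.ofReal ((d : ℝ) ^ 2 / (2 * h t ^ 2)) *
            ENNReal.ofReal (4 * h t ^ 2 / (d - 1)) * 2⁻¹ =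
            ENNReal.ofReal ((d : ℝ) ^ 2 / ((d : ℝ) - 1)) := by
          rw [h2, ← ENNReal.ofReal_mul (by positivity), ← ENNReal.ofReal_mul (by positivity)]
          congr 1
          field_simp
          ring
        have e2 : ENNReal.ofReal ((d : ℝ) ^ 2 / h t ^ 2) * ENNReal.ofReal (σ ^ 2) =
            ENNReal.ofReal ((d : ℝ) ^ 2 * σ ^ 2 / h t ^ 2) := by
          rw [← ENNReal.ofReal_mul (by positivity)]
          congr 1
          ring
        rw [e1, e2, ENNReal.inv_two_add_inv_two, mul_one]

theorem lintegral_ofReal_add_sq_le {Ω : Type*} [MeasurableSpace Ω] {P : Measure Ω}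
    [IsProbabilityMeasure P] {g : Ω → ℝ} (hg : Measurable g) (c : ℝ) :
    ∫⁻ ω, ENNReal.ofReal ((g ω + c) ^ 2) ∂P ≤
      2 * ∫⁻ ω, ENNReal.ofReal (g ω ^ 2) ∂P + ENNReal.ofReal (2 * c ^ 2) := by
  calc _ ≤ ∫⁻ ω, (2 * ENNReal.ofReal (g ω ^ 2) + ENNReal.ofReal (2 * c ^ 2)) ∂P := by
        refine lintegral_mono fun ω => ?_
        rw [← ENNReal.ofReal_ofNat 2, ← ENNReal.ofReal_mul (by norm_num),
          ← ENNReal.ofReal_add (by positivity) (by positivity)]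
        refine ENNReal.ofReal_le_ofReal ?_
        nlinarith [sq_nonneg (g ω - c)]
    _ = _ := by
        rw [lintegral_add_left (by fun_prop), lintegral_const_mul _ (by fun_prop)]
        simp

end ZeroOrder

/-- All expectations, and `κ`, are taken in `[0, ∞]`, so nothing has to be integrable. -/
theorem mainTheorem7 {Ω : Type*} [MeasurableSpace Ω] (P : Measure Ω) [IsProbabilityMeasure P]
    (d : ℕ) (hd : 2 ≤ d) (Lbar : ℝ) (hL : 0 < Lbar)
    (f : EuclideanSpace ℝ (Fin d) → ℝ) (hf : f ∈ ZeroOrder.HolderClass 2 Lbar)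
    (K : ℝ → ℝ) (hK : AEMeasurable K (volume.restrict (Set.Icc (-1 : ℝ) 1)))
    (Θ : Set (EuclideanSpace ℝ (Fin d))) (η h : ℕ → ℝ) (T : ℕ)
    (x ζ : ℕ → Ω → EuclideanSpace ℝ (Fin d)) (r ξ ξ' : ℕ → Ω → ℝ) (σ : ℝ)
    (hrun : ZeroOrder.IsSphereRun P f K Θ η h T x ζ r ξ ξ')
    (hnoise : ZeroOrder.NoiseAssumption P σ T x ζ r ξ ξ')
    (t : ℕ) (ht : t ∈ Finset.Icc 1 T) :
    (∫⁻ ω, ENNReal.ofReal (‖ZeroOrder.gradEstimator f K (h t) (x t ω) (ζ t ω) (r t ω)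
          (ξ t ω) (ξ' t ω)‖ ^ 2) ∂P
      ≤ ENNReal.ofReal ((d : ℝ) ^ 2 / ((d : ℝ) - 1)) * ZeroOrder.kappa K *
          ∫⁻ ω, ENNReal.ofReal ((‖gradient f (x t ω)‖ + Lbar * h t) ^ 2) ∂P
        + ENNReal.ofReal ((d : ℝ) ^ 2 * σ ^ 2 / h t ^ 2) * ZeroOrder.kappa K) ∧
    (∫⁻ ω, ENNReal.ofReal (‖ZeroOrder.gradEstimator f K (h t) (x t ω) (ζ t ω) (r t ω)
          (ξ t ω) (ξ' t ω)‖ ^ 2) ∂P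
      ≤ ENNReal.ofReal (4 * (d : ℝ)) * ZeroOrder.kappa K *
          ∫⁻ ω, ENNReal.ofReal (‖gradient f (x t ω)‖ ^ 2) ∂P
        + ENNReal.ofReal (4 * (d : ℝ) * Lbar ^ 2 * h t ^ 2) * ZeroOrder.kappa K
        + ENNReal.ofReal ((d : ℝ) ^ 2 * σ ^ 2 / h t ^ 2) * ZeroOrder.kappa K) := by
  have hmain := ZeroOrder.lintegral_norm_sq_gradEstimator_le hd hL.le hf hK hrun hnoise ht
  refine ⟨hmain, hmain.trans ?_⟩
  gcongr
  have hd2 : (2 : ℝ) ≤ d := by exact_mod_cast hd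
  have hd1 : (0 : ℝ) < d - 1 := by linarith
  have hx := hrun.measurable_x t ht
  have hgm : Measurable (gradient f) :=
    (ZeroOrder.continuous_gradient (ZeroOrder.HolderClass.contDiff hf)).measurable
  have hcoef : ENNReal.ofReal ((d : ℝ) ^ 2 / ((d : ℝ) - 1)) ≤ ENNReal.ofReal (2 * d) := by
    refine ENNReal.ofReal_le_ofReal ?_
    rw [div_le_iff₀ hd1]
    nlinarith
  have hsq := ZeroOrder.lintegral_ofReal_add_sq_le (P := P)
    (g := fun ω => ‖gradient f (x t ω)‖) (by fun_prop) (Lbar * h t)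
  calc _ ≤ ENNReal.ofReal (2 * d) * ZeroOrder.kappa K *
        (2 * ∫⁻ ω, ENNReal.ofReal (‖gradient f (x t ω)‖ ^ 2) ∂P +
          ENNReal.ofReal (2 * (Lbar * h t) ^ 2)) := by gcongr
    _ = (ENNReal.ofReal (2 * d) * 2) * ZeroOrder.kappa K *
          ∫⁻ ω, ENNReal.ofReal (‖gradient f (x t ω)‖ ^ 2) ∂P +
        (ENNReal.ofReal (2 * d) * ENNReal.ofReal (2 * (Lbar * h t) ^ 2)) * ZeroOrder.kappa K := by
        ring
    _ = _ := by
        have e1 : ENNReal.ofReal (2 * (d : ℝ)) * 2 = ENNReal.ofReal (4 * (d : ℝ)) := by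
          rw [← ENNReal.ofReal_ofNat 2, ← ENNReal.ofReal_mul (by positivity)]
          congr 1
          ring
        have e2 : ENNReal.ofReal (2 * (d : ℝ)) * ENNReal.ofReal (2 * (Lbar * h t) ^ 2) =
            ENNReal.ofReal (4 * (d : ℝ) * Lbar ^ 2 * h t ^ 2) := by
          rw [← ENNReal.ofReal_mul (by positivity)]
          congr 1
          ring
        rw [e1, e2]
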